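/- Let $V$ be a finite-dimensional real Euclidean space, let $W\subset O(V)$ be a finite group generated by reflections, and let $S\subset W$ be the set of all reflections in $W$. Put $\mathfrak h=\mathbb C\otimes_{\mathbb R}V$. For $s\in S$ let $\alpha_s\in\mathfrak h^*$ be the linear function $(a_s,-)$, where $a_s\in V$ is a nonzero vector orthogonal to the reflecting hyperplane of $s$, and let $\alpha_s^\vee=2a_s/(a_s,a_s)\in\mathfrak h$. Let $c:S\to\mathbb C$, $s\mapsto c_s$, be a function invariant under conjugation by $W$. The rational Cherednik algebra $\mathsf H_c$ is the associative $\mathbb C$-algebra generated by the vector spaces $\mathfrak h$, $\mathfrak h^*$ and the group $W$ with the relations $$w x w^{-1}=w(x),\quad w y w^{-1}=w(y),\quad x_1x_2=x_2x_1,\quad y_1y_2=y_2y_1,\quad yx-xy=\langle y,x\rangle-\sum_{s\in S}c_s\langle y,\alpha_s\rangle\langle\alpha_s^\vee,x\rangle\, s$$ for $w\in W$, $x,x_1,x_2\in\mathfrak h^*$, $y,y_1,y_2\in\mathfrak h$. Let $M(\mathsf{triv})=\mathsf H_c\otimes_{\mathbb C[\mathfrak h^*]\# W}\mathsf{triv}$,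 where $W$ acts trivially on $\mathsf{triv}=\mathbb C$ and $P\in\mathbb C[\mathfrak h^*]$ acts by $P(0)$, let $L(\mathsf{triv})$ be its unique simple quotient (the quotient by the sum of all proper submodules), and let $v\in L(\mathsf{triv})$ be the image of $1\otimes 1$. Let $I=\{p\in\mathbb C[\mathfrak h] : p\cdot v=0\}$. If $\dim_{\mathbb C}L(\mathsf{triv})<\infty$, then the map $\mathbb C[\mathfrak h]\to L(\mathsf{triv})$, $p\mapsto p\cdot v$, is surjective and $I$ is a homogeneous ideal, so that $L(\mathsf{triv})=\mathbb C[\mathfrak h]/I$ becomes a graded commutative algebra. This algebra is Gorenstein (it is a Noetherian ring whose localizations at all prime ideals have finite injective dimension over themselves), and it is a Frobenius algebra: it is finite-dimensional and there is a linear functional $\varphi$ on $\mathbb C[\mathfrak h]/I$ such that the bilinear form $(a,b)\mapsto\varphi(ab)$ is nondegenerate. -/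

import Mathlib

open scoped TensorProduct

noncomputable section

namespace RatCherednik

/-! ### Finite real reflection groups -/

section ReflectionGroup

variable {V : Type*} [NormedAddCommGroup V] [InnerProductSpace ℝ V] [FiniteDimensional ℝ V]

/-- `s` is the orthogonal reflection in the hyperplane orthogonal to the nonzero vector `a`. -/
def IsReflectionIn (s : V ≃ₗᵢ[ℝ] V) (a : V) : Prop :=
  a ≠ 0 ∧ s = (ℝ ∙ a)ᗮ.reflection

/-- The set `S` of all reflections contained in `W`. -/
def reflections (W : Subgroup (V ≃ₗᵢ[ℝ] V)) : Set W :=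
  {s | ∃ a : V, IsReflectionIn (s : V ≃ₗᵢ[ℝ] V) a}

/-- `W` is a finite group generated by reflections of the Euclidean space `V`
(a finite Coxeter group in its reflection representation). -/
def IsFiniteReflectionGroup (W : Subgroup (V ≃ₗᵢ[ℝ] V)) : Prop :=
  Finite W ∧ Subgroup.closure (reflections W) = ⊤

/-- A choice of a root for every reflection: `α s` is normal to the reflecting hyperplane `H_s`. -/
def IsRootChoice (W : Subgroup (V ≃ₗᵢ[ℝ] V)) (α : reflections W → V) : Prop :=
  ∀ s : reflections W, IsReflectionIn ((s : W) : V ≃ₗᵢ[ℝ] V) (α s)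

/-- The parameter `c : S → ℂ` is invariant under conjugation by `W`. -/
def IsConjInvariant (W : Subgroup (V ≃ₗᵢ[ℝ] V)) (c : reflections W → ℂ) : Prop :=
  ∀ (w : W) (s t : reflections W), (t : W) = w * (s : W) * w⁻¹ → c t = c s

end ReflectionGroup

section Cherednik

variable (V : Type*) [NormedAddCommGroup V] [InnerProductSpace ℝ V]

/-- The complexification `𝔥` of the Euclidean space `V`. -/
abbrev Cplx : Type _ := ℂ ⊗[ℝ] V

/-- The dual space `𝔥*`. -/
abbrev CplxDual : Type _ := Module.Dual ℂ (Cplx V)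

/-- The algebra `ℂ[𝔥]` of polynomial functions on `𝔥`, i.e. the symmetric algebra of `𝔥*`. -/
abbrev PolyAlg : Type _ := SymmetricAlgebra ℂ (CplxDual V)

variable {V}

/-- The linear function `(a, -)` on `𝔥`, where `( , )` is the complexified inner product. -/
def rootForm (a : V) : CplxDual V :=
  Module.Dual.baseChange ℂ (innerₗ V a)

/-- The coroot `2 a / (a, a) ∈ 𝔥` of the root `(a, -)`. -/
def coroot (a : V) : Cplx V :=
  (1 : ℂ) ⊗ₜ[ℝ] ((2 / inner ℝ a a : ℝ) • a)

/-- The complexified action of an isometry of `V` on `𝔥`. -/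
def actH (w : V ≃ₗᵢ[ℝ] V) : Cplx V →ₗ[ℂ] Cplx V :=
  (w.toLinearEquiv : V →ₗ[ℝ] V).baseChange ℂ

/-- The contragredient action of an isometry of `V` on `𝔥*`: `(w x)(y) = x (w⁻¹ y)`. -/
def actHDual (w : V ≃ₗᵢ[ℝ] V) (x : CplxDual V) : CplxDual V :=
  x ∘ₗ actH w⁻¹

/-! ### The rational Cherednik algebra -/

/-- The generators of `H_c`: the elements of `𝔥`, of `𝔥*` and of `W`. -/
inductive Gen (W : Subgroup (V ≃ₗᵢ[ℝ] V)) : Type _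
  | y (v : Cplx V)
  | x (f : CplxDual V)
  | w (g : W)

namespace Gen

variable (W : Subgroup (V ≃ₗᵢ[ℝ] V))

/-- The generator of the free algebra given by a vector of `𝔥`. -/
def Y (v : Cplx V) : FreeAlgebra ℂ (Gen W) := FreeAlgebra.ι ℂ (Gen.y v)

/-- The generator of the free algebra given by a linear function on `𝔥`. -/
def X (f : CplxDual V) : FreeAlgebra ℂ (Gen W) := FreeAlgebra.ι ℂ (Gen.x f)

/-- The generator of the free algebra given by a group element. -/
def G (g : W) : FreeAlgebra ℂ (Gen W) := FreeAlgebra.ι ℂ (Gen.w g)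

end Gen

open Gen in
/-- The defining relations of `H_c`. The first six say that `𝔥` and `𝔥*` are embedded linearly and
`W` multiplicatively, the others are the relations of the rational Cherednik algebra. -/
inductive Rel (W : Subgroup (V ≃ₗᵢ[ℝ] V)) (α : reflections W → V) (c : reflections W → ℂ) :
    FreeAlgebra ℂ (Gen W) → FreeAlgebra ℂ (Gen W) → Prop
  | y_add (u v : Cplx V) : Rel W α c (Y W (u + v)) (Y W u + Y W v)
  | y_smul (a : ℂ) (v : Cplx V) : Rel W α c (Y W (a • v)) (a • Y W v)
  | x_add (f g : CplxDual V) : Rel W α c (X W (f + g)) (X W f + X W g)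
  | x_smul (a : ℂ) (f : CplxDual V) : Rel W α c (X W (a • f)) (a • X W f)
  | w_one : Rel W α c (G W 1) 1
  | w_mul (g h : W) : Rel W α c (G W (g * h)) (G W g * G W h)
  | conj_x (g : W) (f : CplxDual V) :
      Rel W α c (G W g * X W f * G W g⁻¹) (X W (actHDual (g : V ≃ₗᵢ[ℝ] V) f))
  | conj_y (g : W) (v : Cplx V) :
      Rel W α c (G W g * Y W v * G W g⁻¹) (Y W (actH (g : V ≃ₗᵢ[ℝ] V) v))
  | x_comm (f g : CplxDual V) : Rel W α c (X W f * X W g) (X W g * X W f)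
  | y_comm (u v : Cplx V) : Rel W α c (Y W u * Y W v) (Y W v * Y W u)
  | y_x (v : Cplx V) (f : CplxDual V) :
      Rel W α c (Y W v * X W f - X W f * Y W v)
        (algebraMap ℂ _ (f v) -
          ∑ᶠ s : reflections W,
            (c s * rootForm (α s) v * f (coroot (α s))) • G W (s : W))

variable (W : Subgroup (V ≃ₗᵢ[ℝ] V)) (α : reflections W → V) (c : reflections W → ℂ)

/-- The rational Cherednik algebra `H_c(W)`. -/
def Alg : Type _ := RingQuot (Rel W α c)

instance : Ring (Alg W α c) := inferInstanceAs (Ring (RingQuot (Rel W α c)))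

instance : Algebra ℂ (Alg W α c) := inferInstanceAs (Algebra ℂ (RingQuot (Rel W α c)))

/-- The quotient map from the free algebra onto `H_c`. -/
def Alg.mk : FreeAlgebra ℂ (Gen W) →ₐ[ℂ] Alg W α c := RingQuot.mkAlgHom ℂ (Rel W α c)

variable {W α c} in
theorem Alg.mk_rel {a b : FreeAlgebra ℂ (Gen W)} (h : Rel W α c a b) :
    Alg.mk W α c a = Alg.mk W α c b :=
  RingQuot.mkAlgHom_rel ℂ h

/-- The image of `v ∈ 𝔥` in `H_c`. -/
def Alg.y (v : Cplx V) : Alg W α c := Alg.mk W α c (Gen.Y W v)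

/-- The image of `w ∈ W` in `H_c`. -/
def Alg.w (g : W) : Alg W α c := Alg.mk W α c (Gen.G W g)

/-- The linear map `𝔥* → H_c`. -/
def Alg.x : CplxDual V →ₗ[ℂ] Alg W α c where
  toFun f := Alg.mk W α c (Gen.X W f)
  map_add' f g := by
    rw [Alg.mk_rel (Rel.x_add f g), map_add]
  map_smul' a f := by
    rw [Alg.mk_rel (Rel.x_smul a f), map_smul, RingHom.id_apply]

theorem Alg.x_mul_comm (f g : CplxDual V) :
    Alg.x W α c f * Alg.x W α c g = Alg.x W α c g * Alg.x W α c f := by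
  have h := Alg.mk_rel (Rel.x_comm (W := W) (α := α) (c := c) f g)
  rw [map_mul, map_mul] at h
  exact h

/-- The algebra map `ℂ[𝔥] → H_c` extending `𝔥* → H_c`. -/
def polyHom : PolyAlg V →ₐ[ℂ] Alg W α c :=
  RingCon.liftₐ (TensorAlgebra.symRingCon ℂ (CplxDual V))
    (TensorAlgebra.lift ℂ (Alg.x W α c)) (by
      refine RingCon.ringConGen_le.2 (fun a b h => ?_)
      induction h with
      | mul_comm f g =>
        rw [RingCon.ker_apply]
        simpa using Alg.x_mul_comm W α c f g)

theorem polyHom_ι (f : CplxDual V) :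
    polyHom W α c (SymmetricAlgebra.ι ℂ (CplxDual V) f) = Alg.x W α c f :=
  TensorAlgebra.lift_ι_apply (Alg.x W α c) f

/-! ### Standard modules and their simple quotients -/

section Modules

variable {E : Type*} [AddCommGroup E] [Module ℂ E] (τ : Representation ℂ W E)

/-- The relations `h y ⊗ e = 0` and `h w ⊗ e = h ⊗ τ(w) e` in `H_c ⊗_ℂ τ`. They present the tensor
product of `H_c` with `τ` over `ℂ[𝔥*] # W`, which is generated by `𝔥` and `W` and where `ℂ[𝔥*]` acts
on `τ` by `P ↦ P(0)`. -/
def inductionRelations : Submodule (Alg W α c) (Alg W α c ⊗[ℂ] E) :=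
  Submodule.span (Alg W α c)
    ({m | ∃ (v : Cplx V) (e : E), m = Alg.y W α c v ⊗ₜ[ℂ] e} ∪
      {m | ∃ (g : W) (e : E), m = Alg.w W α c g ⊗ₜ[ℂ] e - 1 ⊗ₜ[ℂ] τ g e})

/-- The standard module `M(τ) = H_c ⊗_{ℂ[𝔥*] # W} τ`. -/
abbrev StandardModule : Type _ := (Alg W α c ⊗[ℂ] E) ⧸ inductionRelations W α c τ

/-- The sum of all proper submodules of `M(τ)`. For irreducible `τ` this is the unique maximal
proper submodule. -/
def maxSubmodule : Submodule (Alg W α c) (StandardModule W α c τ) :=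
  sSup {N | N ≠ ⊤}

/-- The unique simple quotient `L(τ)` of `M(τ)`, for irreducible `τ`. -/
abbrev SimpleModule : Type _ := StandardModule W α c τ ⧸ maxSubmodule W α c τ

end Modules

/-- The module `L(triv)`. -/
abbrev LTriv : Type _ := SimpleModule W α c (Representation.trivial ℂ W ℂ)

/-- The lowest weight vector of `L(triv)`, the image of `1 ⊗ 1`. -/
def lowestVector : LTriv W α c :=
  (maxSubmodule W α c (Representation.trivial ℂ W ℂ)).mkQ
    ((inductionRelations W α c (Representation.trivial ℂ W ℂ)).mkQ
      ((1 : Alg W α c) ⊗ₜ[ℂ] (1 : ℂ)))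

/-- The ideal `I ⊂ ℂ[𝔥]` of all polynomials that kill the lowest weight vector of `L(triv)`. -/
def trivIdeal : Ideal (PolyAlg V) :=
  Ideal.comap (polyHom W α c)
    (LinearMap.ker (LinearMap.toSpanSingleton (Alg W α c) (LTriv W α c) (lowestVector W α c)))

/-- The space of homogeneous polynomials of degree `n` in `ℂ[𝔥]`. -/
def homogeneousPart (V : Type*) [NormedAddCommGroup V] [InnerProductSpace ℝ V] (n : ℕ) :
    Submodule ℂ (PolyAlg V) :=
  LinearMap.range (SymmetricAlgebra.ι ℂ (CplxDual V)) ^ n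

/-- An ideal of `ℂ[𝔥]` is homogeneous if it is generated by homogeneous elements. -/
def IsHomogeneousIdeal (I : Ideal (PolyAlg V)) : Prop :=
  Ideal.span {p | p ∈ I ∧ ∃ n : ℕ, p ∈ homogeneousPart V n} = I

end Cherednik

/-! ### Gorenstein rings and Frobenius algebras -/

/-- A commutative ring is Gorenstein if it is Noetherian and each of its localizations at a prime
ideal has finite injective dimension as a module over itself. -/
def IsGorensteinRing (R : Type*) [CommRing R] : Prop :=
  IsNoetherianRing R ∧ ∀ (p : Ideal R) [p.IsPrime], ∃ n : ℕ,
    CategoryTheory.HasInjectiveDimensionLE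
      (ModuleCat.of (Localization.AtPrime p) (Localization.AtPrime p)) n

/-- A commutative algebra over a field is Frobenius if it is finite-dimensional and has a linear
functional `φ` for which the bilinear form `(a, b) ↦ φ (a * b)` is nondegenerate. -/
def IsFrobeniusAlgebra (k A : Type*) [Field k] [CommRing A] [Algebra k A] : Prop :=
  FiniteDimensional k A ∧ ∃ φ : A →ₗ[k] k, ∀ a : A, (∀ b : A, φ (a * b) = 0) → a = 0

end RatCherednik

end

/-! The proof rests on a copy of `𝔰𝔩₂` inside `H_c`. For dual orthonormal bases `xᵢ`, `yᵢ`, put `E =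
∑ xᵢ²` and `F = ∑ yᵢ²`. Then `[F, xᵢ] = 2yᵢ` and `[E, yᵢ] = -2xᵢ`: by Leibniz a reflection `s`
contributes a multiple of `a_s s + s a_s`, which is zero because `s` negates its root
(`sum_sq_commutator`). Hence `E`, `F` and the grading element `[F, E]/4` satisfy the `𝔰𝔩₂` relations
up to normalization, and the `xᵢ`, `yᵢ` span two-dimensional representations.

On a finite-dimensional `L` the operators `E` and `F` are nilpotent, so the nontrivial Weyl element
of `SL₂` acts as a product of exponentials and exchanges the actions of `𝔥` and `𝔥*` up to sign
(`exists_unit_exchanging`). Vectors of `L(triv)` killed by `𝔥` are multiples of the lowest weight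
vector, since one of positive degree would generate a submodule missing that vector
(`mem_span_of_y_smul_eq_zero`). By the exchange, vectors killed by `𝔥*` also span at most a line.

Under `ℂ[𝔥]/I ≅ L(triv)` those vectors form the common annihilator of the linear forms, which act
nilpotently. Every nonzero ideal meets this line nontrivially, so a functional nonzero on it is a
Frobenius form (`isFrobeniusAlgebra_of_annihilator_le_span`). Frobenius gives self-injective, and
hence Gorenstein. Surjectivity and homogeneity follow from the defining relations and the
independence of weight spaces. -/

open scoped TensorProduct

noncomputable section

namespace RatCherednik

/-! ### Nilpotent exponentials and intertwiners -/

section Exponential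

/-- An eigenvector of `ad h` with nonzero eigenvalue is nilpotent in a finite-dimensional algebra
over a field of characteristic zero. -/
theorem isNilpotent_of_commutator_eq_smul {K A : Type*} [Field K] [CharZero K] [Ring A]
    [Algebra K A] [FiniteDimensional K A] {h e : A} {k : K} (hk : k ≠ 0)
    (hhe : h * e - e * h = k • e) : IsNilpotent e := by
  by_contra hne
  have hpow (n : ℕ) : h * e ^ n - e ^ n * h = ((n : K) * k) • e ^ n := by
    induction n with
    | zero => simp
    | succ n ih =>
      calc h * e ^ (n + 1) - e ^ (n + 1) * h
          = (h * e ^ n - e ^ n * h) * e + e ^ n * (h * e - e * h) := by noncomm_ring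
        _ = _ := by
          rw [ih, hhe, smul_mul_assoc, mul_smul_comm, ← pow_succ, ← add_smul]
          push_cast
          ring_nf
  -- If no power of `e` vanished, `ad h` would have the infinitely many eigenvalues `n k`.
  let D : Module.End K A := LinearMap.mulLeft K h - LinearMap.mulRight K h
  have hinj : Function.Injective fun n : ℕ => (n : K) * k := fun m n hmn =>
    Nat.cast_injective (mul_right_cancel₀ hk hmn)
  refine Set.infinite_range_of_injective hinj (D.finite_hasEigenvalue.subset ?_)
  rintro _ ⟨n, rfl⟩
  exact Module.End.hasEigenvalue_of_hasEigenvector (x := e ^ n)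
    ⟨Module.End.mem_eigenspace_iff.2 (hpow n), fun h0 => hne ⟨n, h0⟩⟩

variable {A : Type*} [Ring A] [Module ℚ A]

/-- `exp (ad e)` applied to `y` when `[e, y] = x` and `[e, x] = 0`. -/
theorem exp_mul_of_commutator_eq {e x y : A} (he : IsNilpotent e)
    (hy : e * y - y * e = x) (hx : e * x = x * e) :
    IsNilpotent.exp e * y = (y + x) * IsNilpotent.exp e := by
  have hpow (n : ℕ) : e ^ (n + 1) * y = y * e ^ (n + 1) + (n + 1 : ℕ) • (x * e ^ n) := by
    induction n with
    | zero => simp [← hy]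
    | succ n ih =>
      have hey : e * y = y * e + x := by rw [← hy]; abel
      calc e ^ (n + 1 + 1) * y = e * (e ^ (n + 1) * y) := by rw [pow_succ' e (n + 1), mul_assoc]
        _ = (e * y) * e ^ (n + 1) + (n + 1 : ℕ) • ((e * x) * e ^ n) := by
          rw [ih, mul_add, mul_smul_comm, mul_assoc, mul_assoc]
        _ = y * e ^ (n + 1 + 1) + (n + 1 + 1 : ℕ) • (x * e ^ (n + 1)) := by
          rw [hey, hx, add_mul, mul_assoc, mul_assoc, ← pow_succ', ← pow_succ', add_assoc,
            succ_nsmul' _ (n + 1)]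
  obtain ⟨k, hk⟩ := he
  -- One exponential is truncated at `k`, the others at `k + 1`: splitting off their zeroth term
  -- leaves sums of equal length to compare.
  have hk' : e ^ (k + 1) = 0 := by rw [pow_succ, hk, zero_mul]
  calc IsNilpotent.exp e * y = y * IsNilpotent.exp e + x * IsNilpotent.exp e := by
        nth_rewrite 3 [IsNilpotent.exp_eq_sum hk]
        rw [IsNilpotent.exp_eq_sum hk', Finset.sum_range_succ', add_mul, mul_add, Finset.sum_mul,
          Finset.mul_sum, Finset.mul_sum, add_right_comm, ← Finset.sum_add_distrib]
        congr 1
        · refine Finset.sum_congr rfl fun n _ => ?_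
          rw [smul_mul_assoc, hpow, mul_smul_comm, mul_smul_comm, smul_add,
            ← Nat.cast_smul_eq_nsmul ℚ, smul_smul]
          congr 2
          rw [Nat.factorial_succ]
          push_cast
          field_simp
        · simp
    _ = _ := (add_mul _ _ _).symm

/-- The action of the nontrivial Weyl group element of `SL₂` exchanges `x i` and `y i`. -/
theorem exists_unit_intertwining {ι : Type*} {e f : A} {x y : ι → A} (he : IsNilpotent e)
    (hf : IsNilpotent f) (hex : ∀ i, e * x i = x i * e) (hfy : ∀ i, f * y i = y i * f)
    (hey : ∀ i, e * y i - y i * e = -x i) (hfx : ∀ i, f * x i - x i * f = y i) :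
    ∃ u : Aˣ, ∀ i, u * y i = -(x i * u) := by
  have hE := (IsNilpotent.isUnit_exp he)
  have hF := (IsNilpotent.isUnit_exp hf)
  -- The usual representative of the Weyl element. Conjugation takes `y` to `y - x` under `exp e`,
  -- then to `-x` under `exp f`, and the last `exp e` fixes `-x`.
  refine ⟨hE.unit * hF.unit * hE.unit, fun i => ?_⟩
  have h1 : IsNilpotent.exp e * y i = (y i + -x i) * IsNilpotent.exp e :=
    exp_mul_of_commutator_eq he (hey i) (by rw [mul_neg, hex, neg_mul])
  have h2 : IsNilpotent.exp f * x i = (x i + y i) * IsNilpotent.exp f :=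
    exp_mul_of_commutator_eq hf (hfx i) (hfy i)
  have h3 : IsNilpotent.exp f * y i = y i * IsNilpotent.exp f := by
    simpa using exp_mul_of_commutator_eq (x := 0) hf (by rw [hfy, sub_self]) (by simp)
  have h4 : IsNilpotent.exp e * x i = x i * IsNilpotent.exp e := by
    simpa using exp_mul_of_commutator_eq (x := 0) he (by rw [hex, sub_self]) (by simp)
  have h5 : IsNilpotent.exp f * (y i + -x i) = -(x i * IsNilpotent.exp f) := by
    rw [mul_add, mul_neg, h2, h3, add_mul]
    abel
  simp only [Units.val_mul, IsUnit.unit_spec]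
  rw [mul_assoc, h1, mul_assoc, ← mul_assoc (IsNilpotent.exp f), h5, neg_mul, mul_neg,
    ← mul_assoc, ← mul_assoc, h4]
  simp only [mul_assoc]

end Exponential

/-! ### Frobenius algebras -/

section Frobenius

variable {k A : Type*} [Field k] [CommRing A] [Algebra k A]

/-- A finite-dimensional commutative algebra is Frobenius if the common annihilator of some
nilpotent elements is at most one-dimensional. -/
theorem isFrobeniusAlgebra_of_annihilator_le_span [FiniteDimensional k A] (S : Set A)
    (hS : ∀ x ∈ S, IsNilpotent x) (s₀ : A)
    (hs₀ : ∀ a, (∀ x ∈ S, x * a = 0) → a ∈ k ∙ s₀) : IsFrobeniusAlgebra k A := by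
  refine ⟨inferInstance, ?_⟩
  have hart : IsArtinianRing A := IsArtinianRing.of_finite k A
  -- A minimal ideal inside `(a)` has a generator `t = b a`. If some `x ∈ S` did not kill `t`,
  -- minimality would give `t = r x t`, hence `t = (r x)ⁿ t = 0` for large `n`.
  have key : ∀ a : A, a ≠ 0 → ∃ b : A, a * b ≠ 0 ∧ a * b ∈ k ∙ s₀ := by
    intro a ha
    obtain ⟨J, hJ, hJa⟩ := (IsAtomic.eq_bot_or_exists_atom_le (Ideal.span {a})).resolve_left
      (by simpa using ha)
    obtain ⟨t, htJ, ht⟩ := J.ne_bot_iff.1 hJ.1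
    obtain ⟨b, rfl⟩ := Ideal.mem_span_singleton'.1 (hJa htJ)
    refine ⟨b, by rwa [mul_comm], hs₀ _ fun x hx => ?_⟩
    rw [mul_comm a b]
    by_contra hne
    have hle : Ideal.span {x * (b * a)} ≤ J :=
      (Ideal.span_singleton_le_iff_mem J).2 (J.mul_mem_left x htJ)
    have heq : Ideal.span {x * (b * a)} = J :=
      (hJ.le_iff.1 hle).resolve_left (by simpa using hne)
    rw [← heq] at htJ
    obtain ⟨r, hr⟩ := Ideal.mem_span_singleton'.1 htJ
    have hpow (n : ℕ) : (r * x) ^ n * (b * a) = b * a := by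
      induction n with
      | zero => simp
      | succ n ih => rw [pow_succ, mul_assoc, mul_assoc r, hr, ih]
    obtain ⟨n, hn⟩ := hS x hx
    exact ht (by rw [← hpow n, mul_pow, hn, mul_zero, zero_mul])
  by_cases h0 : s₀ = 0
  · refine ⟨0, fun a _ => by_contra fun ha => ?_⟩
    obtain ⟨b, hb, hb'⟩ := key a ha
    exact hb (by simpa [h0] using hb')
  · obtain ⟨φ, hφ⟩ : ∃ φ : Module.Dual k A, φ s₀ ≠ 0 := by
      by_contra! h
      exact h0 ((Module.forall_dual_apply_eq_zero_iff k s₀).1 h)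
    refine ⟨φ, fun a ha' => by_contra fun ha => ?_⟩
    obtain ⟨b, hb, hb'⟩ := key a ha
    obtain ⟨m, hm⟩ := Submodule.mem_span_singleton.1 hb'
    have := ha' b
    rw [← hm, map_smul, smul_eq_mul, mul_eq_zero] at this
    rcases this with rfl | h
    · exact hb (by rw [← hm, zero_smul])
    · exact hφ h

/-- A commutative Frobenius algebra is self-injective. -/
theorem IsFrobeniusAlgebra.injective_self (h : IsFrobeniusAlgebra k A) : Module.Injective A A := by
  obtain ⟨hfd, φ, hφ⟩ := h
  let B : A →ₗ[k] Module.Dual k A := (LinearMap.mul k A).compr₂ φ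
  have hB : Function.Injective B := by
    rw [injective_iff_map_eq_zero]
    exact fun a ha => hφ a fun b => LinearMap.congr_fun ha b
  have hB' : Function.Surjective B :=
    (LinearMap.injective_iff_surjective_of_finrank_eq_finrank
      Subspace.dual_finrank_eq.symm).1 hB
  refine Module.Baer.injective fun J g => ?_
  -- The functional `φ ∘ g` extends to `A` and so has the form `φ(b ·)`. Nondegeneracy, tested
  -- against all `d`, upgrades `φ(b d x) = φ(d g(x))` to `g(x) = b x`.
  obtain ⟨ψ, hψ⟩ := LinearMap.exists_extend (p := J.restrictScalars k)
    (φ ∘ₗ (g.restrictScalars k : J.restrictScalars k →ₗ[k] A))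
  obtain ⟨b, rfl⟩ := hB' ψ
  refine ⟨LinearMap.mulLeft A b, fun x hx => ?_⟩
  rw [← sub_eq_zero]
  refine hφ _ fun d => ?_
  have h1 := LinearMap.congr_fun hψ ⟨d * x, J.mul_mem_left d hx⟩
  have h2 : g ⟨d * x, J.mul_mem_left d hx⟩ = d * g ⟨x, hx⟩ := g.map_smul d ⟨x, hx⟩
  change φ (b * (d * x)) = φ (g ⟨d * x, J.mul_mem_left d hx⟩) at h1
  rw [h2] at h1
  rw [sub_mul, map_sub, sub_eq_zero, LinearMap.mulLeft_apply, mul_comm (g _) d, ← h1]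
  congr 1
  ring

/-- Self-injectivity of a Noetherian ring passes to its localizations, so the injective dimension is
`0` at every prime. -/
theorem IsFrobeniusAlgebra.isGorensteinRing (h : IsFrobeniusAlgebra k A) : IsGorensteinRing A := by
  have hfd := h.1
  have hart : IsArtinianRing A := IsArtinianRing.of_finite k A
  have hnoeth : IsNoetherianRing A := inferInstance
  refine ⟨hnoeth, fun p _ => ⟨0, ?_⟩⟩
  have hinj := h.injective_self
  have hloc : Module.Injective (Localization.AtPrime p) (Localization.AtPrime p) :=
    Module.injective_of_isLocalizedModule p.primeCompl
      (Algebra.linearMap A (Localization.AtPrime p))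
  rw [Module.injective_iff_injective_object] at hloc
  exact CategoryTheory.injective_iff_hasInjectiveDimensionLT_one.1 hloc

end Frobenius

/-! ### Commutation relations in the rational Cherednik algebra -/

/-- The Leibniz rule, with `hw` cancelling the group terms. The abstract form serves both choices of
which of `𝔥`, `𝔥*` is squared. -/
theorem sum_sq_commutator {K A ι σ : Type*} [Field K] [Ring A] [Algebra K A] [Fintype ι]
    [Fintype σ] (p : ι → A) (q : A) (d : ι → K) (k : σ → K) (r : σ → ι → K) (w : σ → A)
    (hpq : ∀ i, p i * q - q * p i = algebraMap K A (d i) - ∑ s, (k s * r s i) • w s)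
    (hw : ∀ s, (∑ i, r s i • p i) * w s + w s * (∑ i, r s i • p i) = 0) :
    (∑ i, p i * p i) * q - q * ∑ i, p i * p i = (2 : K) • ∑ i, d i • p i := by
  have h1 (i : ι) : p i * p i * q - q * (p i * p i) =
      (2 : K) • d i • p i - ∑ s, k s • ((r s i • p i) * w s + w s * (r s i • p i)) := by
    calc p i * p i * q - q * (p i * p i)
        = p i * (p i * q - q * p i) + (p i * q - q * p i) * p i := by noncomm_ring
      _ = _ := by
        rw [hpq, mul_sub, sub_mul, Finset.mul_sum, Finset.sum_mul, ← Algebra.commutes,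
          ← Algebra.smul_def, two_smul, sub_add_sub_comm, ← Finset.sum_add_distrib]
        congr 1
        refine Finset.sum_congr rfl fun s _ => ?_
        simp only [smul_mul_assoc, mul_smul_comm, smul_add, smul_smul]
  have h2 : ∑ i, ∑ s, k s • ((r s i • p i) * w s + w s * (r s i • p i)) = 0 := by
    rw [Finset.sum_comm]
    refine Finset.sum_eq_zero fun s _ => ?_
    rw [← Finset.smul_sum, Finset.sum_add_distrib, ← Finset.sum_mul, ← Finset.mul_sum, hw,
      smul_zero]
  rw [Finset.sum_mul, Finset.mul_sum, ← Finset.sum_sub_distrib, Finset.sum_congr rfl fun i _ => h1 i,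
    Finset.sum_sub_distrib, h2, sub_zero, Finset.smul_sum]

section Relations

variable {V : Type*} [NormedAddCommGroup V] [InnerProductSpace ℝ V]

@[simp]
theorem rootForm_tmul (a v : V) (z : ℂ) : rootForm a (z ⊗ₜ v) = z * (inner ℝ a v : ℝ) := by
  simp [rootForm, mul_comm]

@[simp]
theorem actH_tmul (w : V ≃ₗᵢ[ℝ] V) (v : V) (z : ℂ) : actH w (z ⊗ₜ v) = z ⊗ₜ w v := by
  simp [actH]

theorem actHDual_rootForm (w : V ≃ₗᵢ[ℝ] V) (a : V) :
    actHDual w (rootForm a) = rootForm (w a) := by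
  refine TensorProduct.AlgebraTensorModule.curry_injective ?_
  ext v
  have h : inner ℝ a (w.symm v) = inner ℝ (w a) v := by
    rw [← w.inner_map_map a (w.symm v)]
    exact congrArg _ (w.apply_symm_apply v)
  simp [actHDual, h]

theorem rootForm_neg (a : V) : rootForm (-a) = -rootForm a := by
  refine TensorProduct.AlgebraTensorModule.curry_injective ?_
  ext v
  simp

theorem IsReflectionIn.apply_self {s : V ≃ₗᵢ[ℝ] V} {a : V} (h : IsReflectionIn s a) : s a = -a := by
  rw [h.2]
  exact Submodule.reflection_orthogonalComplement_singleton_eq_neg a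

variable {ι : Type*} [Fintype ι] (b : OrthonormalBasis ι ℝ V)

theorem sum_inner_smul_tmul (a : V) :
    ∑ i, ((inner ℝ a (b i) : ℝ) : ℂ) • ((1 : ℂ) ⊗ₜ[ℝ] b i) = (1 : ℂ) ⊗ₜ a := by
  conv_rhs => rw [← b.sum_repr' a, TensorProduct.tmul_sum]
  refine Finset.sum_congr rfl fun i _ => ?_
  rw [TensorProduct.tmul_smul, real_inner_comm]
  simp [TensorProduct.smul_tmul']

theorem sum_apply_smul_rootForm (f : CplxDual V) :
    ∑ i, f (1 ⊗ₜ b i) • rootForm (b i) = f := by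
  refine TensorProduct.AlgebraTensorModule.curry_injective ?_
  ext v
  have := congrArg f (sum_inner_smul_tmul b v)
  simp only [map_sum, map_smul, smul_eq_mul] at this
  simp only [TensorProduct.AlgebraTensorModule.curry_apply,
    TensorProduct.curry_apply, LinearMap.coe_restrictScalars, LinearMap.sum_apply,
    LinearMap.smul_apply, rootForm_tmul, smul_eq_mul, one_mul, ← this]
  refine Finset.sum_congr rfl fun i _ => ?_
  rw [mul_comm, real_inner_comm]

theorem sum_rootForm_smul_tmul (u : Cplx V) :
    ∑ i, rootForm (b i) u • ((1 : ℂ) ⊗ₜ[ℝ] b i) = u := by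
  induction u using TensorProduct.induction_on with
  | zero => simp
  | add u v hu hv =>
    simp only [map_add, add_smul, Finset.sum_add_distrib, hu, hv]
  | tmul z v =>
    calc _ = z • ∑ i, ((inner ℝ v (b i) : ℝ) : ℂ) • ((1 : ℂ) ⊗ₜ[ℝ] b i) := by
          rw [Finset.smul_sum]
          refine Finset.sum_congr rfl fun i _ => ?_
          rw [rootForm_tmul, real_inner_comm, mul_smul]
      _ = _ := by rw [sum_inner_smul_tmul]; simp [TensorProduct.smul_tmul']

variable (W : Subgroup (V ≃ₗᵢ[ℝ] V)) (α : reflections W → V) (c : reflections W → ℂ)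

/-- The linear map `𝔥 → H_c`. -/
def Alg.yₗ : Cplx V →ₗ[ℂ] Alg W α c where
  toFun := Alg.y W α c
  map_add' u v := by
    change Alg.mk W α c _ = _
    rw [Alg.mk_rel (Rel.y_add u v), map_add]
    rfl
  map_smul' a v := by
    change Alg.mk W α c _ = _
    rw [Alg.mk_rel (Rel.y_smul a v), map_smul]
    rfl

theorem Alg.yₗ_apply (v : Cplx V) : Alg.yₗ W α c v = Alg.y W α c v := rfl

theorem Alg.y_mul_comm (u v : Cplx V) :
    Alg.y W α c u * Alg.y W α c v = Alg.y W α c v * Alg.y W α c u := by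
  have h := Alg.mk_rel (Rel.y_comm (W := W) (α := α) (c := c) u v)
  rwa [map_mul, map_mul] at h

theorem Alg.w_one : Alg.w W α c 1 = 1 := by
  rw [Alg.w, Alg.mk_rel Rel.w_one, map_one]

theorem Alg.w_mul (g h : W) : Alg.w W α c (g * h) = Alg.w W α c g * Alg.w W α c h := by
  rw [Alg.w, Alg.mk_rel (Rel.w_mul g h), map_mul]
  rfl

theorem Alg.w_inv_mul (g : W) : Alg.w W α c g⁻¹ * Alg.w W α c g = 1 := by
  rw [← Alg.w_mul, inv_mul_cancel, Alg.w_one]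

theorem Alg.w_mul_x (g : W) (f : CplxDual V) :
    Alg.w W α c g * Alg.x W α c f = Alg.x W α c (actHDual (g : V ≃ₗᵢ[ℝ] V) f) * Alg.w W α c g := by
  have h : Alg.w W α c g * Alg.x W α c f * Alg.w W α c g⁻¹ =
      Alg.x W α c (actHDual (g : V ≃ₗᵢ[ℝ] V) f) := by
    have h := Alg.mk_rel (Rel.conj_x (W := W) (α := α) (c := c) g f)
    rwa [map_mul, map_mul] at h
  rw [← h, mul_assoc _ (Alg.w W α c g⁻¹), Alg.w_inv_mul, mul_one]

theorem Alg.w_mul_y (g : W) (v : Cplx V) :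
    Alg.w W α c g * Alg.y W α c v = Alg.y W α c (actH (g : V ≃ₗᵢ[ℝ] V) v) * Alg.w W α c g := by
  have h : Alg.w W α c g * Alg.y W α c v * Alg.w W α c g⁻¹ =
      Alg.y W α c (actH (g : V ≃ₗᵢ[ℝ] V) v) := by
    have h := Alg.mk_rel (Rel.conj_y (W := W) (α := α) (c := c) g v)
    rwa [map_mul, map_mul] at h
  rw [← h, mul_assoc _ (Alg.w W α c g⁻¹), Alg.w_inv_mul, mul_one]

variable [Fintype (reflections W)]

theorem Alg.y_mul_x_sub (v : Cplx V) (f : CplxDual V) :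
    Alg.y W α c v * Alg.x W α c f - Alg.x W α c f * Alg.y W α c v =
      algebraMap ℂ _ (f v) -
        ∑ s : reflections W, (c s * rootForm (α s) v * f (coroot (α s))) • Alg.w W α c (s : W) := by
  have h := Alg.mk_rel (Rel.y_x (W := W) (α := α) (c := c) v f)
  rw [finsum_eq_sum_of_fintype, map_sub, map_sub, map_mul, map_mul, map_sum, AlgHom.commutes] at h
  simp only [map_smul] at h
  exact h

/-- The element `∑ xᵢ²` of `H_c`. -/
def Alg.sumSqX : Alg W α c := ∑ i, Alg.x W α c (rootForm (b i)) * Alg.x W α c (rootForm (b i))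

/-- The element `∑ yᵢ²` of `H_c`. -/
def Alg.sumSqY : Alg W α c := ∑ i, Alg.y W α c (1 ⊗ₜ b i) * Alg.y W α c (1 ⊗ₜ b i)

variable {α}

theorem Alg.sumSqY_mul_x_sub (hα : IsRootChoice W α) (j : ι) :
    Alg.sumSqY b W α c * Alg.x W α c (rootForm (b j)) -
      Alg.x W α c (rootForm (b j)) * Alg.sumSqY b W α c = (2 : ℂ) • Alg.y W α c (1 ⊗ₜ b j) := by
  classical
  have hsum (a : V) : ∑ i, ((inner ℝ a (b i) : ℝ) : ℂ) • Alg.y W α c (1 ⊗ₜ b i) =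
      Alg.y W α c (1 ⊗ₜ a) := by
    simp only [← Alg.yₗ_apply, ← map_smul, ← map_sum, sum_inner_smul_tmul]
  have key := sum_sq_commutator (fun i => Alg.y W α c (1 ⊗ₜ b i)) (Alg.x W α c (rootForm (b j)))
    (fun i => ((inner ℝ (b j) (b i) : ℝ) : ℂ))
    (fun s : reflections W => c s * rootForm (b j) (coroot (α s)))
    (fun s i => ((inner ℝ (α s) (b i) : ℝ) : ℂ)) (fun s => Alg.w W α c (s : W))
    (fun i => by
      rw [Alg.y_mul_x_sub]
      simp only [rootForm_tmul, one_mul]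
      congr 1
      exact Finset.sum_congr rfl fun s _ => by rw [mul_right_comm])
    (fun s => by
      rw [hsum, Alg.w_mul_y, actH_tmul, (hα s).apply_self, TensorProduct.tmul_neg,
        ← Alg.yₗ_apply, ← Alg.yₗ_apply, map_neg, neg_mul, add_neg_cancel])
  rw [hsum] at key
  exact key

theorem Alg.y_mul_sumSqX_sub (hα : IsRootChoice W α) (j : ι) :
    Alg.sumSqX b W α c * Alg.y W α c (1 ⊗ₜ b j) - Alg.y W α c (1 ⊗ₜ b j) * Alg.sumSqX b W α c =
      -((2 : ℂ) • Alg.x W α c (rootForm (b j))) := by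
  classical
  have hsum (a : V) : ∑ i, ((inner ℝ (b i) a : ℝ) : ℂ) • Alg.x W α c (rootForm (b i)) =
      Alg.x W α c (rootForm a) := by
    simp only [← map_smul, ← map_sum]
    rw [← sum_apply_smul_rootForm b (rootForm a)]
    simp [real_inner_comm]
  have key := sum_sq_commutator (fun i => Alg.x W α c (rootForm (b i))) (Alg.y W α c (1 ⊗ₜ b j))
    (fun i => -((inner ℝ (b i) (b j) : ℝ) : ℂ))
    -- The factor `2 / (α_s, α_s)` of the coroot goes into `k`, so that `∑ r s i • p i` is exactly
    -- the root form that `s` negates.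
    (fun s : reflections W => -(c s * rootForm (α s) (1 ⊗ₜ b j) *
      ((2 / inner ℝ (α s) (α s) : ℝ) : ℂ)))
    (fun s i => ((inner ℝ (b i) (α s) : ℝ) : ℂ)) (fun s => Alg.w W α c (s : W))
    (fun i => by
      rw [← neg_sub, Alg.y_mul_x_sub, neg_sub, map_neg, sub_eq_neg_add]
      rw [sub_eq_add_neg, ← Finset.sum_neg_distrib]
      congr 1
      · simp
      · refine Finset.sum_congr rfl fun s _ => ?_
        rw [← neg_smul, coroot, rootForm_tmul _ _ (1 : ℂ), rootForm_tmul, real_inner_smul_right]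
        push_cast
        congr 1
        ring)
    (fun s => by
      rw [hsum, Alg.w_mul_x, actHDual_rootForm, (hα s).apply_self, rootForm_neg, map_neg,
        neg_mul, add_neg_cancel])
  simp only [neg_smul, Finset.sum_neg_distrib, hsum, smul_neg] at key
  exact key

end Relations

/-! ### The grading element -/

section Euler

variable {V : Type*} [NormedAddCommGroup V] [InnerProductSpace ℝ V]
variable {ι : Type*} [Fintype ι] (b : OrthonormalBasis ι ℝ V)
variable (W : Subgroup (V ≃ₗᵢ[ℝ] V)) {α : reflections W → V} (c : reflections W → ℂ)

theorem Alg.x_eq_sum (f : CplxDual V) :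
    Alg.x W α c f = ∑ i, f (1 ⊗ₜ b i) • Alg.x W α c (rootForm (b i)) := by
  conv_lhs => rw [← sum_apply_smul_rootForm b f]
  simp

theorem Alg.y_eq_sum (u : Cplx V) :
    Alg.y W α c u = ∑ i, rootForm (b i) u • Alg.y W α c (1 ⊗ₜ b i) := by
  conv_lhs => rw [← sum_rootForm_smul_tmul b u]
  simp only [← Alg.yₗ_apply, map_sum, map_smul]

theorem Alg.sumSqX_mul_x (f : CplxDual V) :
    Alg.sumSqX b W α c * Alg.x W α c f = Alg.x W α c f * Alg.sumSqX b W α c := by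
  rw [Alg.sumSqX, Finset.sum_mul, Finset.mul_sum]
  refine Finset.sum_congr rfl fun i _ => ?_
  rw [mul_assoc, Alg.x_mul_comm W α c _ f, ← mul_assoc, Alg.x_mul_comm W α c _ f, mul_assoc]

theorem Alg.sumSqY_mul_y (u : Cplx V) :
    Alg.sumSqY b W α c * Alg.y W α c u = Alg.y W α c u * Alg.sumSqY b W α c := by
  rw [Alg.sumSqY, Finset.sum_mul, Finset.mul_sum]
  refine Finset.sum_congr rfl fun i _ => ?_
  rw [mul_assoc, Alg.y_mul_comm W α c _ u, ← mul_assoc, Alg.y_mul_comm W α c _ u, mul_assoc]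

variable (α) in
/-- The grading element of `H_c`, a multiple of the commutator of `∑ yᵢ²` and `∑ xᵢ²`. -/
def Alg.euler : Alg W α c :=
  (1 / 4 : ℂ) • (Alg.sumSqY b W α c * Alg.sumSqX b W α c -
    Alg.sumSqX b W α c * Alg.sumSqY b W α c)

variable [Fintype (reflections W)]

/-- The Jacobi identity for `[[F, E], x]`, with `[E, x] = 0`, `[F, x] = 2y` and `[E, y] = -2x`. The
reflection terms have already cancelled in these brackets. -/
theorem Alg.euler_mul_x_sub (hα : IsRootChoice W α) (f : CplxDual V) :
    Alg.euler b W α c * Alg.x W α c f - Alg.x W α c f * Alg.euler b W α c = Alg.x W α c f := by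
  have h (j : ι) : Alg.euler b W α c * Alg.x W α c (rootForm (b j)) -
      Alg.x W α c (rootForm (b j)) * Alg.euler b W α c = Alg.x W α c (rootForm (b j)) := by
    have h1 := Alg.sumSqY_mul_x_sub b W c hα j
    have h2 := Alg.y_mul_sumSqX_sub b W c hα j
    have h3 := Alg.sumSqX_mul_x b W (α := α) c (rootForm (b j))
    set E := Alg.sumSqX b W α c
    set F := Alg.sumSqY b W α c
    set x := Alg.x W α c (rootForm (b j))
    set y := Alg.y W α c (1 ⊗ₜ b j)
    calc Alg.euler b W α c * x - x * Alg.euler b W α c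
        = (1 / 4 : ℂ) • (F * (E * x - x * E) - (E * x - x * E) * F +
            ((F * x - x * F) * E - E * (F * x - x * F))) := by
          rw [Alg.euler, smul_mul_assoc, mul_smul_comm, ← smul_sub]
          congr 1
          noncomm_ring
      _ = -(1 / 2 : ℂ) • (E * y - y * E) := by
          rw [h1, h3, sub_self, zero_mul, mul_zero, sub_zero, zero_add, smul_mul_assoc,
            mul_smul_comm, ← smul_sub, smul_smul, ← neg_sub (E * y), smul_neg, neg_smul]
          norm_num
      _ = x := by
          rw [h2, smul_neg, neg_smul, neg_neg, smul_smul]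
          norm_num
  rw [Alg.x_eq_sum b W c f, Finset.mul_sum, Finset.sum_mul, ← Finset.sum_sub_distrib]
  refine Finset.sum_congr rfl fun i _ => ?_
  rw [mul_smul_comm, smul_mul_assoc, ← smul_sub, h]

theorem Alg.euler_mul_y_sub (hα : IsRootChoice W α) (u : Cplx V) :
    Alg.euler b W α c * Alg.y W α c u - Alg.y W α c u * Alg.euler b W α c = -Alg.y W α c u := by
  have h (j : ι) : Alg.euler b W α c * Alg.y W α c (1 ⊗ₜ b j) -
      Alg.y W α c (1 ⊗ₜ b j) * Alg.euler b W α c = -Alg.y W α c (1 ⊗ₜ b j) := by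
    have h1 := Alg.sumSqY_mul_x_sub b W c hα j
    have h2 := Alg.y_mul_sumSqX_sub b W c hα j
    have h3 := Alg.sumSqY_mul_y b W (α := α) c (1 ⊗ₜ b j)
    set E := Alg.sumSqX b W α c
    set F := Alg.sumSqY b W α c
    set x := Alg.x W α c (rootForm (b j))
    set y := Alg.y W α c (1 ⊗ₜ b j)
    calc Alg.euler b W α c * y - y * Alg.euler b W α c
        = (1 / 4 : ℂ) • (F * (E * y - y * E) - (E * y - y * E) * F +
            ((F * y - y * F) * E - E * (F * y - y * F))) := by
          rw [Alg.euler, smul_mul_assoc, mul_smul_comm, ← smul_sub]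
          congr 1
          noncomm_ring
      _ = (-(1 / 2) : ℂ) • (F * x - x * F) := by
          rw [h2, h3, sub_self, zero_mul, mul_zero, sub_zero, add_zero, mul_neg, neg_mul,
            smul_mul_assoc, mul_smul_comm, ← neg_sub', ← smul_sub, smul_neg, smul_smul, neg_smul]
          norm_num
      _ = -y := by
          rw [h1, smul_smul]
          norm_num
  rw [Alg.y_eq_sum b W c u, Finset.mul_sum, Finset.sum_mul, ← Finset.sum_sub_distrib,
    ← Finset.sum_neg_distrib]
  refine Finset.sum_congr rfl fun i _ => ?_
  rw [mul_smul_comm, smul_mul_assoc, ← smul_sub, h, smul_neg]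

theorem Alg.euler_mul_sumSqX_sub (hα : IsRootChoice W α) :
    Alg.euler b W α c * Alg.sumSqX b W α c - Alg.sumSqX b W α c * Alg.euler b W α c =
      (2 : ℂ) • Alg.sumSqX b W α c := by
  rw [Alg.sumSqX, Finset.mul_sum, Finset.sum_mul, ← Finset.sum_sub_distrib, Finset.smul_sum]
  refine Finset.sum_congr rfl fun i _ => ?_
  set x := Alg.x W α c (rootForm (b i)) with hx
  calc _ = (Alg.euler b W α c * x - x * Alg.euler b W α c) * x +
        x * (Alg.euler b W α c * x - x * Alg.euler b W α c) := by noncomm_ring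
    _ = _ := by rw [hx, Alg.euler_mul_x_sub b W c hα, two_smul]

theorem Alg.euler_mul_sumSqY_sub (hα : IsRootChoice W α) :
    Alg.euler b W α c * Alg.sumSqY b W α c - Alg.sumSqY b W α c * Alg.euler b W α c =
      (-2 : ℂ) • Alg.sumSqY b W α c := by
  rw [Alg.sumSqY, Finset.mul_sum, Finset.sum_mul, ← Finset.sum_sub_distrib, Finset.smul_sum]
  refine Finset.sum_congr rfl fun i _ => ?_
  set y := Alg.y W α c (1 ⊗ₜ b i) with hy
  calc _ = (Alg.euler b W α c * y - y * Alg.euler b W α c) * y +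
        y * (Alg.euler b W α c * y - y * Alg.euler b W α c) := by noncomm_ring
    _ = _ := by
      rw [hy, Alg.euler_mul_y_sub b W c hα, neg_smul, two_smul, mul_neg, neg_mul, neg_add]

/-- Expands `[F, xᵢ²]` by Leibniz. In this form the action on the lowest weight vector is visibly
scalar. -/
theorem Alg.euler_eq_sum (hα : IsRootChoice W α) :
    Alg.euler b W α c = (1 / 2 : ℂ) • ∑ i,
      (Alg.y W α c (1 ⊗ₜ b i) * Alg.x W α c (rootForm (b i)) +
        Alg.x W α c (rootForm (b i)) * Alg.y W α c (1 ⊗ₜ b i)) := by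
  have h (i : ι) : Alg.sumSqY b W α c *
      (Alg.x W α c (rootForm (b i)) * Alg.x W α c (rootForm (b i))) -
      (Alg.x W α c (rootForm (b i)) * Alg.x W α c (rootForm (b i))) * Alg.sumSqY b W α c =
      (2 : ℂ) • (Alg.y W α c (1 ⊗ₜ b i) * Alg.x W α c (rootForm (b i)) +
        Alg.x W α c (rootForm (b i)) * Alg.y W α c (1 ⊗ₜ b i)) := by
    rw [smul_add, ← smul_mul_assoc, ← mul_smul_comm, ← Alg.sumSqY_mul_x_sub b W c hα i]
    noncomm_ring
  rw [Alg.euler]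
  conv_lhs => rw [Alg.sumSqX, Finset.mul_sum, Finset.sum_mul, ← Finset.sum_sub_distrib]
  rw [Finset.sum_congr rfl fun i _ => h i, ← Finset.smul_sum, smul_smul]
  norm_num

end Euler

/-! ### Polynomials -/

section Polynomials

variable {V : Type*} [NormedAddCommGroup V] [InnerProductSpace ℝ V]

theorem iSup_homogeneousPart : ⨆ n, homogeneousPart V n = ⊤ := by
  rw [eq_top_iff]
  rintro p -
  have hle (n : ℕ) : homogeneousPart V n ≤ ⨆ n, homogeneousPart V n := le_iSup _ n
  induction p using SymmetricAlgebra.induction with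
  | algebraMap r => exact hle 0 (by simp [homogeneousPart])
  | ι f => exact hle 1 (by simp [homogeneousPart])
  | add p q hp hq => exact add_mem hp hq
  | mul p q hp hq =>
    have := Submodule.mul_mem_mul hp hq
    rw [Submodule.iSup_mul] at this
    simp only [Submodule.mul_iSup] at this
    refine (iSup_le fun m => iSup_le fun n => ?_ :
      (⨆ i, ⨆ j, homogeneousPart V i * homogeneousPart V j) ≤ _) this
    rw [homogeneousPart, homogeneousPart, ← pow_add]
    exact hle (m + n)

/-- Existence suffices: degrees are later separated by the weight spaces of the module, not inside
`ℂ[𝔥]`. -/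
theorem exists_homogeneous_decomposition (p : PolyAlg V) :
    ∃ (s : Finset ℕ) (q : ℕ → PolyAlg V), (∀ n, q n ∈ homogeneousPart V n) ∧
      ∑ n ∈ s, q n = p := by
  have hp : p ∈ ⨆ n, homogeneousPart V n := by rw [iSup_homogeneousPart]; trivial
  obtain ⟨q, hq, hsum⟩ := (Submodule.mem_iSup_iff_exists_finsupp _ _).1 hp
  exact ⟨q.support, q, hq, hsum⟩

end Polynomials

/-! ### Lowest weight modules -/

section LowestWeight

variable {V : Type*} [NormedAddCommGroup V] [InnerProductSpace ℝ V]
variable (W : Subgroup (V ≃ₗᵢ[ℝ] V)) (α : reflections W → V) (c : reflections W → ℂ)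
variable {L : Type*} [AddCommGroup L] [Module ℂ L] [Module (Alg W α c) L]

theorem w_mul_polyHom {n : ℕ} {p : PolyAlg V} (hp : p ∈ homogeneousPart V n) (g : W) :
    ∃ q ∈ homogeneousPart V n,
      Alg.w W α c g * polyHom W α c p = polyHom W α c q * Alg.w W α c g := by
  induction hp using Submodule.pow_induction_on_left' with
  | algebraMap r =>
    exact ⟨algebraMap ℂ _ r, by simp [homogeneousPart], by
      rw [AlgHom.commutes, Algebra.commutes]⟩
  | add x y i _ _ hx hy =>
    obtain ⟨q, hq, hq'⟩ := hx
    obtain ⟨r, hr, hr'⟩ := hy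
    exact ⟨q + r, add_mem hq hr, by rw [map_add, map_add, mul_add, add_mul, hq', hr']⟩
  | mem_mul m hm i x _ hx =>
    obtain ⟨q, hq, hq'⟩ := hx
    obtain ⟨f, rfl⟩ := hm
    refine ⟨SymmetricAlgebra.ι ℂ _ (actHDual (g : V ≃ₗᵢ[ℝ] V) f) * q, ?_, ?_⟩
    · rw [homogeneousPart, Nat.succ_eq_add_one, pow_succ']
      exact Submodule.mul_mem_mul ⟨_, rfl⟩ hq
    · rw [map_mul, map_mul, polyHom_ι, polyHom_ι, ← mul_assoc, Alg.w_mul_x, mul_assoc, hq',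
        mul_assoc]

/-- The subspace `ℂ[𝔥] U`. -/
def polySpan (U : Submodule ℂ L) : Submodule ℂ L :=
  Submodule.span ℂ {m | ∃ p : PolyAlg V, ∃ u ∈ U, m = polyHom W α c p • u}

variable {W α c} in
theorem polyHom_smul_mem_polySpan {U : Submodule ℂ L} (p : PolyAlg V) {u : L} (hu : u ∈ U) :
    polyHom W α c p • u ∈ polySpan W α c U :=
  Submodule.subset_span ⟨p, u, hu, rfl⟩

variable [IsScalarTower ℂ (Alg W α c) L]

/-- A subspace that is stable under the generators of `H_c` is a submodule. -/
def submoduleOfGenerators (T : Submodule ℂ L) (hx : ∀ f, ∀ u ∈ T, Alg.x W α c f • u ∈ T)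
    (hy : ∀ v, ∀ u ∈ T, Alg.y W α c v • u ∈ T) (hw : ∀ g, ∀ u ∈ T, Alg.w W α c g • u ∈ T) :
    Submodule (Alg W α c) L where
  __ := T
  smul_mem' := by
    intro a u hu
    change a • u ∈ T
    change u ∈ T at hu
    obtain ⟨a, rfl⟩ : ∃ a', Alg.mk W α c a' = a := RingQuot.mkAlgHom_surjective ℂ _ a
    induction a using FreeAlgebra.induction generalizing u with
    | grade0 r =>
      rw [AlgHom.commutes, algebraMap_smul]
      exact T.smul_mem r hu
    | grade1 g =>
      cases g with
      | y v => exact hy v u hu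
      | x f => exact hx f u hu
      | w g => exact hw g u hu
    | mul a b ha hb =>
      rw [map_mul, mul_smul]
      exact ha (hb hu)
    | add a b ha hb =>
      rw [map_add, add_smul]
      exact add_mem (ha hu) (hb hu)

theorem x_smul_mem_polySpan {U : Submodule ℂ L} (f : CplxDual V) {m : L}
    (hm : m ∈ polySpan W α c U) : Alg.x W α c f • m ∈ polySpan W α c U := by
  have : SMulCommClass (Alg W α c) ℂ L := IsScalarTower.to_smulCommClass'
  induction hm using Submodule.span_induction with
  | mem m hm =>
    obtain ⟨p, u, hu, rfl⟩ := hm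
    rw [← polyHom_ι, ← mul_smul, ← map_mul]
    exact polyHom_smul_mem_polySpan _ hu
  | zero => rw [smul_zero]; exact zero_mem _
  | add a b _ _ ha hb => rw [smul_add]; exact add_mem ha hb
  | smul r a _ ha => rw [smul_comm]; exact Submodule.smul_mem _ r ha

variable {ι : Type*} [Fintype ι] (b : OrthonormalBasis ι ℝ V)

variable (L) in
/-- The eigenspace of the grading element with eigenvalue `μ`. -/
def weightSpace (μ : ℂ) : Submodule ℂ L :=
  (Algebra.lsmul ℂ ℂ L (Alg.euler b W α c)).eigenspace μ

theorem mem_weightSpace {μ : ℂ} {u : L} :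
    u ∈ weightSpace W α c L b μ ↔ Alg.euler b W α c • u = μ • u :=
  Module.End.mem_eigenspace_iff

variable (L) in
theorem iSupIndep_weightSpace (μ : ℂ) : iSupIndep fun n : ℕ => weightSpace W α c L b (μ + n) :=
  (Module.End.eigenspaces_iSupIndep _).comp (f := fun n : ℕ => μ + (n : ℂ))
    fun m n h => by simpa using h

variable [Fintype (reflections W)]

/-- Elements of `W` and `𝔥` are moved to the right past the linear factors of a polynomial until
they reach `U`. -/
theorem generators_smul_mem_polySpan {U : Submodule ℂ L}
    (hw : ∀ g, ∀ u ∈ U, Alg.w W α c g • u ∈ U) (hy : ∀ v, ∀ u ∈ U, Alg.y W α c v • u = 0)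
    {m : L} (hm : m ∈ polySpan W α c U) :
    (∀ g, Alg.w W α c g • m ∈ polySpan W α c U) ∧
      ∀ v, Alg.y W α c v • m ∈ polySpan W α c U := by
  have : SMulCommClass (Alg W α c) ℂ L := IsScalarTower.to_smulCommClass'
  induction hm using Submodule.span_induction with
  | zero => exact ⟨fun g => by rw [smul_zero]; exact zero_mem _,
      fun v => by rw [smul_zero]; exact zero_mem _⟩
  | add a b _ _ ha hb => exact ⟨fun g => by rw [smul_add]; exact add_mem (ha.1 g) (hb.1 g),
      fun v => by rw [smul_add]; exact add_mem (ha.2 v) (hb.2 v)⟩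
  | smul r a _ ha => exact ⟨fun g => by rw [smul_comm]; exact Submodule.smul_mem _ r (ha.1 g),
      fun v => by rw [smul_comm]; exact Submodule.smul_mem _ r (ha.2 v)⟩
  | mem m hm =>
    obtain ⟨p, u, hu, rfl⟩ := hm
    -- Stability under `W` and `𝔥` is proved jointly, since `y x - x y` contains group elements.
    -- Quantifying over all `m` lets the product case compose.
    let Q (m : L) : Prop := m ∈ polySpan W α c U ∧ (∀ g, Alg.w W α c g • m ∈ polySpan W α c U) ∧
      ∀ v, Alg.y W α c v • m ∈ polySpan W α c U
    suffices h : ∀ m, Q m → Q (polyHom W α c p • m) from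
      (h u ⟨by simpa using polyHom_smul_mem_polySpan (W := W) (α := α) (c := c) 1 hu,
        fun g => by simpa using polyHom_smul_mem_polySpan (W := W) (α := α) (c := c) 1 (hw g u hu),
        fun v => by rw [hy v u hu]; exact zero_mem _⟩).2
    clear! u
    induction p using SymmetricAlgebra.induction with
    | algebraMap r =>
      intro m hm
      rw [AlgHom.commutes, algebraMap_smul]
      exact ⟨Submodule.smul_mem _ r hm.1,
        fun g => by rw [smul_comm]; exact Submodule.smul_mem _ r (hm.2.1 g),
        fun v => by rw [smul_comm]; exact Submodule.smul_mem _ r (hm.2.2 v)⟩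
    | add p q hp hq =>
      intro m hm
      rw [map_add, add_smul]
      exact ⟨add_mem (hp m hm).1 (hq m hm).1,
        fun g => by rw [smul_add]; exact add_mem ((hp m hm).2.1 g) ((hq m hm).2.1 g),
        fun v => by rw [smul_add]; exact add_mem ((hp m hm).2.2 v) ((hq m hm).2.2 v)⟩
    | mul p q hp hq =>
      intro m hm
      rw [map_mul, mul_smul]
      exact hp _ (hq m hm)
    | ι f =>
      intro m hm
      rw [polyHom_ι]
      refine ⟨x_smul_mem_polySpan W α c f hm.1, fun g => ?_, fun v => ?_⟩
      · rw [← mul_smul, Alg.w_mul_x, mul_smul]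
        exact x_smul_mem_polySpan W α c _ (hm.2.1 g)
      · rw [← mul_smul, sub_eq_iff_eq_add.1 (Alg.y_mul_x_sub W α c v f), add_smul, sub_smul,
          algebraMap_smul, mul_smul, Finset.sum_smul]
        refine add_mem (sub_mem (Submodule.smul_mem _ _ hm.1) (Submodule.sum_mem _ fun s _ => ?_))
          (x_smul_mem_polySpan W α c f (hm.2.2 v))
        rw [smul_assoc]
        exact Submodule.smul_mem _ _ (hm.2.1 _)

/-- If `U` is stable under `W` and killed by `𝔥` then `ℂ[𝔥] U` is an `H_c`-submodule. -/
def polySpanSubmodule (U : Submodule ℂ L) (hw : ∀ g, ∀ u ∈ U, Alg.w W α c g • u ∈ U)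
    (hy : ∀ v, ∀ u ∈ U, Alg.y W α c v • u = 0) : Submodule (Alg W α c) L :=
  submoduleOfGenerators W α c (polySpan W α c U) (fun f _ hm => x_smul_mem_polySpan W α c f hm)
    (fun v _ hm => (generators_smul_mem_polySpan W α c hw hy hm).2 v)
    (fun g _ hm => (generators_smul_mem_polySpan W α c hw hy hm).1 g)

variable {α}

theorem x_smul_mem_weightSpace (hα : IsRootChoice W α) {μ : ℂ} {u : L}
    (hu : u ∈ weightSpace W α c L b μ) (f : CplxDual V) :
    Alg.x W α c f • u ∈ weightSpace W α c L b (μ + 1) := by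
  have : SMulCommClass (Alg W α c) ℂ L := IsScalarTower.to_smulCommClass'
  rw [mem_weightSpace] at hu ⊢
  rw [← mul_smul, sub_eq_iff_eq_add.1 (Alg.euler_mul_x_sub b W c hα f), add_smul, mul_smul, hu,
    smul_comm, add_smul, one_smul, add_comm]

theorem y_smul_mem_weightSpace (hα : IsRootChoice W α) {μ : ℂ} {u : L}
    (hu : u ∈ weightSpace W α c L b μ) (v : Cplx V) :
    Alg.y W α c v • u ∈ weightSpace W α c L b (μ - 1) := by
  have : SMulCommClass (Alg W α c) ℂ L := IsScalarTower.to_smulCommClass'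
  rw [mem_weightSpace] at hu ⊢
  rw [← mul_smul, sub_eq_iff_eq_add.1 (Alg.euler_mul_y_sub b W c hα v), add_smul, mul_smul, hu,
    smul_comm, sub_smul, one_smul, neg_smul, neg_add_eq_sub]

theorem polyHom_smul_mem_weightSpace (hα : IsRootChoice W α) {μ : ℂ} {u : L}
    (hu : u ∈ weightSpace W α c L b μ) {n : ℕ} {p : PolyAlg V} (hp : p ∈ homogeneousPart V n) :
    polyHom W α c p • u ∈ weightSpace W α c L b (μ + n) := by
  induction hp using Submodule.pow_induction_on_left' with
  | algebraMap r =>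
    rw [AlgHom.commutes, algebraMap_smul, Nat.cast_zero, add_zero]
    exact Submodule.smul_mem _ r hu
  | add x y i _ _ hx hy =>
    rw [map_add, add_smul]
    exact add_mem hx hy
  | mem_mul m hm i x _ hx =>
    obtain ⟨f, rfl⟩ := hm
    rw [map_mul, mul_smul, polyHom_ι, Nat.succ_eq_add_one, Nat.cast_add, Nat.cast_one, ← add_assoc]
    exact x_smul_mem_weightSpace W c b hα hx f

/-- A vector that is fixed by `W` and killed by `𝔥` is an eigenvector of the grading element. -/
theorem exists_mem_weightSpace (hα : IsRootChoice W α) {v : L}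
    (hw : ∀ g, Alg.w W α c g • v = v) (hy : ∀ u, Alg.y W α c u • v = 0) :
    ∃ μ, v ∈ weightSpace W α c L b μ := by
  have : SMulCommClass (Alg W α c) ℂ L := IsScalarTower.to_smulCommClass'
  -- After `y x` is rewritten through `x y`, all terms ending in `y` kill `v`, and each reflection
  -- acts as `1`.
  have h (i : ι) : ∃ r : ℂ, (Alg.y W α c (1 ⊗ₜ b i) * Alg.x W α c (rootForm (b i)) +
      Alg.x W α c (rootForm (b i)) * Alg.y W α c (1 ⊗ₜ b i)) • v = r • v := by
    rw [sub_eq_iff_eq_add.1 (Alg.y_mul_x_sub W α c _ _)]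
    simp only [add_smul, sub_smul, mul_smul _ (Alg.y W α c _), hy, smul_zero, add_zero,
      algebraMap_smul, Finset.sum_smul, smul_assoc, hw]
    rw [← Finset.sum_smul, ← sub_smul]
    exact ⟨_, rfl⟩
  choose r hr using h
  refine ⟨(1 / 2 : ℂ) * ∑ i, r i, ?_⟩
  rw [mem_weightSpace, Alg.euler_eq_sum b W c hα, smul_assoc, Finset.sum_smul,
    Finset.sum_congr rfl fun i _ => hr i, ← Finset.sum_smul, smul_smul]

theorem isNilpotent_lsmul_x [FiniteDimensional ℝ V] [FiniteDimensional ℂ L]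
    (hα : IsRootChoice W α) (f : CplxDual V) :
    IsNilpotent (Algebra.lsmul ℂ ℂ L (Alg.x W α c f)) := by
  let b := stdOrthonormalBasis ℝ V
  refine isNilpotent_of_commutator_eq_smul (K := ℂ)
    (h := Algebra.lsmul ℂ ℂ L (Alg.euler b W α c)) one_ne_zero ?_
  rw [← map_mul, ← map_mul, ← map_sub, Alg.euler_mul_x_sub b W c hα, one_smul]

/-- On a finite-dimensional module, the nontrivial Weyl group element of `SL₂` exchanges the
actions of `𝔥` and `𝔥*`. -/
theorem exists_unit_exchanging [FiniteDimensional ℂ L] (hα : IsRootChoice W α) :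
    ∃ Φ : (Module.End ℂ L)ˣ, ∀ i u, Φ.1 (Alg.y W α c (1 ⊗ₜ b i) • u) =
      -(Alg.x W α c (rootForm (b i)) • Φ.1 u) := by
  let ρ : Alg W α c →ₐ[ℂ] Module.End ℂ L := Algebra.lsmul ℂ ℂ L
  -- The factors `1/2` normalize the brackets to `[e, yᵢ] = -xᵢ` and `[f, xᵢ] = yᵢ`.
  set e : Alg W α c := (1 / 2 : ℂ) • Alg.sumSqX b W α c with he
  set f : Alg W α c := (1 / 2 : ℂ) • Alg.sumSqY b W α c with hf
  set h : Alg W α c := Alg.euler b W α c with hh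
  have hhe : h * e - e * h = (2 : ℂ) • e := by
    rw [he, hh, mul_smul_comm, smul_mul_assoc, ← smul_sub, Alg.euler_mul_sumSqX_sub b W c hα,
      smul_comm]
  have hhf : h * f - f * h = (-2 : ℂ) • f := by
    rw [hf, hh, mul_smul_comm, smul_mul_assoc, ← smul_sub, Alg.euler_mul_sumSqY_sub b W c hα,
      smul_comm]
  have hE : IsNilpotent (ρ e) := isNilpotent_of_commutator_eq_smul (K := ℂ) (h := ρ h) two_ne_zero
    (by rw [← map_mul, ← map_mul, ← map_sub, hhe, map_smul])
  have hF : IsNilpotent (ρ f) := isNilpotent_of_commutator_eq_smul (K := ℂ) (h := ρ h)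
    (neg_ne_zero.2 two_ne_zero) (by rw [← map_mul, ← map_mul, ← map_sub, hhf, map_smul])
  have hex (i : ι) : e * Alg.x W α c (rootForm (b i)) = Alg.x W α c (rootForm (b i)) * e := by
    rw [he, smul_mul_assoc, mul_smul_comm, Alg.sumSqX_mul_x]
  have hfy (i : ι) : f * Alg.y W α c (1 ⊗ₜ b i) = Alg.y W α c (1 ⊗ₜ b i) * f := by
    rw [hf, smul_mul_assoc, mul_smul_comm, Alg.sumSqY_mul_y]
  have hey (i : ι) : e * Alg.y W α c (1 ⊗ₜ b i) - Alg.y W α c (1 ⊗ₜ b i) * e =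
      -Alg.x W α c (rootForm (b i)) := by
    rw [he, smul_mul_assoc, mul_smul_comm, ← smul_sub, Alg.y_mul_sumSqX_sub b W c hα, smul_neg,
      smul_smul]
    norm_num
  have hfx (i : ι) : f * Alg.x W α c (rootForm (b i)) - Alg.x W α c (rootForm (b i)) * f =
      Alg.y W α c (1 ⊗ₜ b i) := by
    rw [hf, smul_mul_assoc, mul_smul_comm, ← smul_sub, Alg.sumSqY_mul_x_sub b W c hα, smul_smul]
    norm_num
  let _ : Module ℚ (Module.End ℂ L) := Module.compHom _ (algebraMap ℚ ℂ)
  obtain ⟨Φ, hΦ⟩ := exists_unit_intertwining (x := fun i => ρ (Alg.x W α c (rootForm (b i))))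
    (y := fun i => ρ (Alg.y W α c (1 ⊗ₜ b i))) hE hF
    (fun i => by rw [← map_mul, ← map_mul, hex]) (fun i => by rw [← map_mul, ← map_mul, hfy])
    (fun i => by rw [← map_mul, ← map_mul, ← map_sub, ← map_neg, hey])
    (fun i => by rw [← map_mul, ← map_mul, ← map_sub, hfx])
  exact ⟨Φ, fun i u => LinearMap.congr_fun (hΦ i) u⟩

end LowestWeight

/-! ### The module `L(triv)`: singular vectors, grading and duality -/

section SimpleQuotient

variable {V : Type*} [NormedAddCommGroup V] [InnerProductSpace ℝ V]
variable (W : Subgroup (V ≃ₗᵢ[ℝ] V)) (α : reflections W → V) (c : reflections W → ℂ)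

/-- The lowest weight vector of `M(triv)`. -/
def standardVector : StandardModule W α c (Representation.trivial ℂ W ℂ) :=
  (inductionRelations W α c (Representation.trivial ℂ W ℂ)).mkQ ((1 : Alg W α c) ⊗ₜ[ℂ] (1 : ℂ))

theorem lowestVector_eq_mkQ : lowestVector W α c =
    (maxSubmodule W α c (Representation.trivial ℂ W ℂ)).mkQ (standardVector W α c) := rfl

theorem exists_smul_standardVector (m : StandardModule W α c (Representation.trivial ℂ W ℂ)) :
    ∃ a : Alg W α c, a • standardVector W α c = m := by
  obtain ⟨t, rfl⟩ := Submodule.mkQ_surjective _ m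
  have ht : ∃ a : Alg W α c, a • ((1 : Alg W α c) ⊗ₜ[ℂ] (1 : ℂ)) = t := by
    induction t using TensorProduct.induction_on with
    | zero => exact ⟨0, zero_smul _ _⟩
    | tmul a z =>
      refine ⟨z • a, ?_⟩
      rw [TensorProduct.smul_tmul', smul_eq_mul, mul_one, TensorProduct.smul_tmul, smul_eq_mul,
        mul_one]
    | add s t hs ht =>
      obtain ⟨a, rfl⟩ := hs
      obtain ⟨b, rfl⟩ := ht
      exact ⟨a + b, add_smul _ _ _⟩
  obtain ⟨a, rfl⟩ := ht
  exact ⟨a, (map_smul _ _ _).symm⟩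

theorem exists_smul_lowestVector (u : LTriv W α c) :
    ∃ a : Alg W α c, a • lowestVector W α c = u := by
  obtain ⟨m, rfl⟩ := Submodule.mkQ_surjective _ u
  obtain ⟨a, rfl⟩ := exists_smul_standardVector W α c m
  exact ⟨a, by rw [lowestVector_eq_mkQ, map_smul]⟩

theorem y_smul_lowestVector (v : Cplx V) : Alg.y W α c v • lowestVector W α c = 0 := by
  have h : Alg.y W α c v • standardVector W α c = 0 := by
    rw [standardVector, ← map_smul, Submodule.mkQ_apply, Submodule.Quotient.mk_eq_zero]
    refine Submodule.subset_span (Or.inl ⟨v, 1, ?_⟩)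
    rw [TensorProduct.smul_tmul', smul_eq_mul, mul_one]
  rw [lowestVector_eq_mkQ, ← map_smul, h, map_zero]

theorem w_smul_lowestVector (g : W) : Alg.w W α c g • lowestVector W α c = lowestVector W α c := by
  have h : Alg.w W α c g • standardVector W α c = standardVector W α c := by
    rw [standardVector, ← map_smul, ← sub_eq_zero, ← map_sub, Submodule.mkQ_apply,
      Submodule.Quotient.mk_eq_zero]
    refine Submodule.subset_span (Or.inr ⟨g, 1, ?_⟩)
    rw [TensorProduct.smul_tmul', smul_eq_mul, mul_one]
    rfl
  rw [lowestVector_eq_mkQ, ← map_smul, h]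

/-- A submodule of `L(triv)` that does not contain the lowest weight vector is zero. -/
theorem eq_bot_of_lowestVector_notMem {N : Submodule (Alg W α c) (LTriv W α c)}
    (hN : lowestVector W α c ∉ N) : N = ⊥ := by
  set K := maxSubmodule W α c (Representation.trivial ℂ W ℂ)
  -- The preimage of `N` misses the generator, so it is one of the proper submodules summed in `K`.
  have hle : N.comap K.mkQ ≤ K :=
    le_sSup (a := N.comap K.mkQ) fun h => hN (by
      have : standardVector W α c ∈ N.comap K.mkQ := by rw [h]; trivial
      exact this)
  rw [eq_bot_iff]
  intro u hu
  obtain ⟨m, rfl⟩ := Submodule.mkQ_surjective _ u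
  exact (Submodule.Quotient.mk_eq_zero K).2 (hle hu)

/-- The linear map `ℂ[𝔥] → L(triv)` given by the action on the lowest weight vector. -/
def actOnLowestVector : PolyAlg V →ₗ[ℂ] LTriv W α c :=
  (LinearMap.toSpanSingleton (Alg W α c) (LTriv W α c) (lowestVector W α c)).restrictScalars ℂ ∘ₗ
    (polyHom W α c).toLinearMap

theorem actH_actH_inv (g : V ≃ₗᵢ[ℝ] V) (v : Cplx V) : actH g (actH g⁻¹ v) = v := by
  induction v using TensorProduct.induction_on with
  | zero => simp
  | tmul z v => rw [actH_tmul, actH_tmul]; exact congrArg _ (g.apply_symm_apply v)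
  | add u v hu hv => rw [map_add, map_add, hu, hv]

variable [Fintype (reflections W)]

/-- The line of the lowest weight vector is `W`-stable and killed by `𝔥`, so `ℂ[𝔥] v` is a
submodule; it contains the generator `v`. -/
theorem polyHom_smul_lowestVector_surjective :
    Function.Surjective fun p : PolyAlg V => polyHom W α c p • lowestVector W α c := by
  intro u
  have hw : ∀ g, ∀ u ∈ ℂ ∙ lowestVector W α c, Alg.w W α c g • u ∈ ℂ ∙ lowestVector W α c := by
    intro g u hu
    obtain ⟨r, rfl⟩ := Submodule.mem_span_singleton.1 hu
    rw [smul_comm, w_smul_lowestVector]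
    exact hu
  have hy : ∀ v, ∀ u ∈ ℂ ∙ lowestVector W α c, Alg.y W α c v • u = 0 := by
    intro v u hu
    obtain ⟨r, rfl⟩ := Submodule.mem_span_singleton.1 hu
    rw [smul_comm, y_smul_lowestVector, smul_zero]
  have hv : lowestVector W α c ∈ polySpanSubmodule W α c _ hw hy := by
    have := polyHom_smul_mem_polySpan (α := α) (c := c) 1
      (Submodule.mem_span_singleton_self (R := ℂ) (lowestVector W α c))
    rwa [map_one, one_smul] at this
  obtain ⟨a, rfl⟩ := exists_smul_lowestVector W α c u
  have hm : a • lowestVector W α c ∈ polySpan W α c (ℂ ∙ lowestVector W α c) :=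
    Submodule.smul_mem _ a hv
  generalize a • lowestVector W α c = m at hm
  induction hm using Submodule.span_induction with
  | mem m hm =>
    obtain ⟨p, u, hu, rfl⟩ := hm
    obtain ⟨r, rfl⟩ := Submodule.mem_span_singleton.1 hu
    exact ⟨r • p, by simp only [map_smul, smul_assoc]; rw [smul_comm]⟩
  | zero => exact ⟨0, by simp⟩
  | add m n _ _ hm hn =>
    obtain ⟨p, rfl⟩ := hm
    obtain ⟨q, rfl⟩ := hn
    exact ⟨p + q, by simp only [map_add, add_smul]⟩
  | smul r m _ hm =>
    obtain ⟨p, rfl⟩ := hm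
    exact ⟨r • p, by simp only [map_smul, smul_assoc]⟩

variable {α} {ι : Type*} [Fintype ι] (b : OrthonormalBasis ι ℝ V)

/-- A vector of positive degree in `L(triv)` that is killed by `𝔥` is zero. -/
theorem eq_zero_of_singular (hα : IsRootChoice W α) {μ : ℂ}
    (hμ : lowestVector W α c ∈ weightSpace W α c (LTriv W α c) b μ) {n : ℕ} {p : PolyAlg V}
    (hp : p ∈ homogeneousPart V (n + 1))
    (hy : ∀ v, Alg.y W α c v • polyHom W α c p • lowestVector W α c = 0) :
    polyHom W α c p • lowestVector W α c = 0 := by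
  by_cases h0 : lowestVector W α c = 0
  · rw [h0, smul_zero]
  -- All singular vectors of degree `n + 1` are taken at once, which makes the space stable under
  -- `W`.
  let U : Submodule ℂ (LTriv W α c) := (homogeneousPart V (n + 1)).map (actOnLowestVector W α c) ⊓
    ⨅ v, LinearMap.ker (Algebra.lsmul ℂ ℂ (LTriv W α c) (Alg.y W α c v))
  have hU {u : LTriv W α c} : u ∈ U ↔ (∃ q ∈ homogeneousPart V (n + 1),
      polyHom W α c q • lowestVector W α c = u) ∧ ∀ v, Alg.y W α c v • u = 0 := by
    simp only [U, Submodule.mem_inf, Submodule.mem_iInf, Submodule.mem_map, LinearMap.mem_ker]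
    rfl
  have hUw : ∀ g, ∀ u ∈ U, Alg.w W α c g • u ∈ U := by
    intro g u hu
    obtain ⟨⟨q, hq, rfl⟩, hu⟩ := hU.1 hu
    refine hU.2 ⟨?_, fun v => ?_⟩
    · obtain ⟨r, hr, hr'⟩ := w_mul_polyHom W α c hq g
      exact ⟨r, hr, by rw [← mul_smul, hr', mul_smul, w_smul_lowestVector]⟩
    · have h := Alg.w_mul_y W α c g (actH (g : V ≃ₗᵢ[ℝ] V)⁻¹ v)
      rw [actH_actH_inv] at h
      rw [← mul_smul (Alg.y W α c v), ← h, mul_smul, hu, smul_zero]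
  have hUy : ∀ v, ∀ u ∈ U, Alg.y W α c v • u = 0 := fun v u hu => (hU.1 hu).2 v
  -- The submodule generated by `U` has only weights `μ + j` with `j > 0`, hence cannot contain the
  -- nonzero vector `v` of weight `μ`.
  have hle : polySpan W α c U ≤ ⨆ (j : ℕ) (_ : j ≠ 0), weightSpace W α c (LTriv W α c) b (μ + j) := by
    refine Submodule.span_le.2 ?_
    rintro _ ⟨q, u, hu, rfl⟩
    obtain ⟨⟨r, hr, rfl⟩, -⟩ := hU.1 hu
    obtain ⟨s, q, hq, rfl⟩ := exists_homogeneous_decomposition q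
    rw [map_sum, Finset.sum_smul]
    refine Submodule.sum_mem _ fun m _ => ?_
    refine Submodule.mem_iSup_of_mem (n + 1 + m) (Submodule.mem_iSup_of_mem (by omega) ?_)
    rw [Nat.cast_add, ← add_assoc]
    exact polyHom_smul_mem_weightSpace W c b hα (polyHom_smul_mem_weightSpace W c b hα hμ hr) (hq m)
  have hbot : polySpanSubmodule W α c U hUw hUy = ⊥ := by
    refine eq_bot_of_lowestVector_notMem W α c fun hv => h0 ?_
    have hdisj := iSupIndep_weightSpace W α c (LTriv W α c) b μ 0
    simp only [Nat.cast_zero, add_zero] at hdisj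
    exact Submodule.disjoint_def.1 hdisj _ hμ (hle hv)
  have hmem : polyHom W α c p • lowestVector W α c ∈ polySpanSubmodule W α c U hUw hUy := by
    have := polyHom_smul_mem_polySpan (α := α) (c := c) 1 (hU.2 ⟨⟨p, hp, rfl⟩, hy⟩)
    rwa [map_one, one_smul] at this
  rw [hbot] at hmem
  exact hmem

/-- The vectors of `L(triv)` that are killed by `𝔥` are the multiples of the lowest weight
vector. -/
theorem mem_span_of_y_smul_eq_zero (hα : IsRootChoice W α) {μ : ℂ}
    (hμ : lowestVector W α c ∈ weightSpace W α c (LTriv W α c) b μ) {u : LTriv W α c}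
    (hu : ∀ v, Alg.y W α c v • u = 0) : u ∈ ℂ ∙ lowestVector W α c := by
  obtain ⟨p, rfl⟩ := polyHom_smul_lowestVector_surjective W α c u
  obtain ⟨s, q, hq, rfl⟩ := exists_homogeneous_decomposition p
  -- Each `y` lowers every weight by one, so the images of the homogeneous components stay
  -- independent and vanish separately.
  have hq0 : ∀ v, ∀ n ∈ s, Alg.y W α c v • polyHom W α c (q n) • lowestVector W α c = 0 := by
    intro v
    refine (iSupIndep_iff_finsetSum_eq_zero_imp_eq_zero _).1
      (iSupIndep_weightSpace W α c (LTriv W α c) b (μ - 1)) s _ (fun n _ => ?_) ?_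
    · rw [sub_add_eq_add_sub]
      exact y_smul_mem_weightSpace W c b hα (polyHom_smul_mem_weightSpace W c b hα hμ (hq n)) v
    · rw [← Finset.smul_sum, ← Finset.sum_smul, ← map_sum]
      exact hu v
  simp only [map_sum, Finset.sum_smul]
  refine Submodule.sum_mem _ fun n hn => ?_
  cases n with
  | zero =>
    obtain ⟨r, hr⟩ : ∃ r, algebraMap ℂ (PolyAlg V) r = q 0 := by
      simpa [homogeneousPart, Submodule.mem_one] using hq 0
    rw [← hr, AlgHom.commutes, algebraMap_smul]
    exact Submodule.smul_mem _ r (Submodule.mem_span_singleton_self _)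
  | succ n =>
    rw [eq_zero_of_singular W c b hα hμ (hq _) fun v => hq0 v _ hn]
    exact zero_mem _

/-- Components of `p` of different degrees send `v` to different weight spaces, so `p v = 0` forces
each component into `I`. -/
theorem trivIdeal_isHomogeneous (hα : IsRootChoice W α) {μ : ℂ}
    (hμ : lowestVector W α c ∈ weightSpace W α c (LTriv W α c) b μ) :
    IsHomogeneousIdeal (trivIdeal W α c) := by
  refine le_antisymm (Ideal.span_le.2 fun p hp => hp.1) fun p hp => ?_
  obtain ⟨s, q, hq, rfl⟩ := exists_homogeneous_decomposition p
  refine Ideal.sum_mem _ fun n hn => Ideal.subset_span ⟨?_, n, hq n⟩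
  refine (iSupIndep_iff_finsetSum_eq_zero_imp_eq_zero _).1
    (iSupIndep_weightSpace W α c (LTriv W α c) b μ) s
    (fun n => polyHom W α c (q n) • lowestVector W α c)
    (fun n _ => polyHom_smul_mem_weightSpace W c b hα hμ (hq n)) ?_ n hn
  rw [← Finset.sum_smul, ← map_sum]
  exact hp

/-- The vectors of `L(triv)` that are killed by `𝔥*` form a space of dimension at most one. -/
theorem exists_mem_span_of_x_smul_eq_zero [FiniteDimensional ℝ V]
    [FiniteDimensional ℂ (LTriv W α c)]
    (hα : IsRootChoice W α) : ∃ u₀ : LTriv W α c,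
      ∀ u, (∀ f, Alg.x W α c f • u = 0) → u ∈ ℂ ∙ u₀ := by
  let b := stdOrthonormalBasis ℝ V
  obtain ⟨μ, hμ⟩ := exists_mem_weightSpace W c b hα
    (w_smul_lowestVector W α c) (y_smul_lowestVector W α c)
  obtain ⟨Φ, hΦ⟩ := exists_unit_exchanging (L := LTriv W α c) W c b hα
  have hinv (u : LTriv W α c) : Φ.1 (Φ⁻¹.1 u) = u := LinearMap.congr_fun Φ.mul_inv u
  have hinv' (u : LTriv W α c) : Φ⁻¹.1 (Φ.1 u) = u := LinearMap.congr_fun Φ.inv_mul u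
  -- If `𝔥*` kills `u`, then `𝔥` kills `Φ⁻¹ u`, which is therefore a multiple of the lowest weight
  -- vector.
  refine ⟨Φ.1 (lowestVector W α c), fun u hu => ?_⟩
  have hy (i) : Alg.y W α c (1 ⊗ₜ b i) • Φ⁻¹.1 u = 0 := by
    have h : Φ.1 (Alg.y W α c (1 ⊗ₜ b i) • Φ⁻¹.1 u) =
        -(Alg.x W α c (rootForm (b i)) • Φ.1 (Φ⁻¹.1 u)) := hΦ i (Φ⁻¹.1 u)
    rw [hinv, hu, neg_zero] at h
    rw [← hinv' (Alg.y W α c (1 ⊗ₜ b i) • Φ⁻¹.1 u), h, map_zero]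
  have hmem := mem_span_of_y_smul_eq_zero W c b hα hμ (u := Φ⁻¹.1 u) fun v => by
    rw [Alg.y_eq_sum b W c v, Finset.sum_smul]
    exact Finset.sum_eq_zero fun i _ => by rw [smul_assoc, hy, smul_zero]
  obtain ⟨r, hr⟩ := Submodule.mem_span_singleton.1 hmem
  exact Submodule.mem_span_singleton.2 ⟨r, by rw [← map_smul, hr, hinv]⟩

/-- The bijection of `ℂ[𝔥]/I` with `L(triv)` turns multiplication by a linear form into its action,
so the annihilator criterion applies. -/
theorem quotient_trivIdeal_isFrobeniusAlgebra [FiniteDimensional ℝ V]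
    [FiniteDimensional ℂ (LTriv W α c)]
    (hα : IsRootChoice W α) : IsFrobeniusAlgebra ℂ (PolyAlg V ⧸ trivIdeal W α c) := by
  let ψ := actOnLowestVector W α c
  have hker : (trivIdeal W α c).restrictScalars ℂ ≤ LinearMap.ker ψ := fun p hp => hp
  let Ψ : (PolyAlg V ⧸ trivIdeal W α c) →ₗ[ℂ] LTriv W α c :=
    { toFun := Submodule.liftQ ((trivIdeal W α c).restrictScalars ℂ) ψ hker
      map_add' := map_add (Submodule.liftQ ((trivIdeal W α c).restrictScalars ℂ) ψ hker)
      map_smul' := map_smul (Submodule.liftQ ((trivIdeal W α c).restrictScalars ℂ) ψ hker) }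
  have hΨ (p : PolyAlg V) : Ψ (Ideal.Quotient.mk _ p) = polyHom W α c p • lowestVector W α c := rfl
  have hinj : Function.Injective Ψ := by
    rw [injective_iff_map_eq_zero]
    intro a ha
    obtain ⟨p, rfl⟩ := Ideal.Quotient.mk_surjective a
    exact Ideal.Quotient.eq_zero_iff_mem.2 ha
  have hsurj : Function.Surjective Ψ := fun u => by
    obtain ⟨p, rfl⟩ := polyHom_smul_lowestVector_surjective W α c u
    exact ⟨Ideal.Quotient.mk _ p, rfl⟩
  have hfd : FiniteDimensional ℂ (PolyAlg V ⧸ trivIdeal W α c) :=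
    FiniteDimensional.of_injective Ψ hinj
  obtain ⟨u₀, hu₀⟩ := exists_mem_span_of_x_smul_eq_zero W c hα
  obtain ⟨s₀, rfl⟩ := hsurj u₀
  refine isFrobeniusAlgebra_of_annihilator_le_span
    (Set.range fun f => Ideal.Quotient.mk (trivIdeal W α c) (SymmetricAlgebra.ι ℂ _ f)) ?_ s₀ ?_
  · rintro _ ⟨f, rfl⟩
    obtain ⟨n, hn⟩ := isNilpotent_lsmul_x (L := LTriv W α c) W c hα f
    refine ⟨n, ?_⟩
    rw [← map_pow, Ideal.Quotient.eq_zero_iff_mem]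
    change polyHom W α c (SymmetricAlgebra.ι ℂ _ f ^ n) • lowestVector W α c = 0
    rw [map_pow, polyHom_ι]
    rw [← map_pow] at hn
    exact LinearMap.congr_fun hn _
  · intro a ha
    have hmem : Ψ a ∈ ℂ ∙ Ψ s₀ := by
      refine hu₀ _ fun f => ?_
      have hf := ha _ ⟨f, rfl⟩
      obtain ⟨p, rfl⟩ := Ideal.Quotient.mk_surjective a
      rw [← map_mul] at hf
      rw [hΨ, ← polyHom_ι, ← mul_smul, ← map_mul, ← hΨ, hf, map_zero]
    obtain ⟨r, hr⟩ := Submodule.mem_span_singleton.1 hmem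
    exact Submodule.mem_span_singleton.2 ⟨r, hinj (by rw [map_smul, hr])⟩

end SimpleQuotient

end RatCherednik

end

theorem mainTheorem11 {V : Type*} [NormedAddCommGroup V] [InnerProductSpace ℝ V]
    [FiniteDimensional ℝ V] (W : Subgroup (V ≃ₗᵢ[ℝ] V))
    (hW : RatCherednik.IsFiniteReflectionGroup W)
    (α : RatCherednik.reflections W → V) (hα : RatCherednik.IsRootChoice W α)
    (c : RatCherednik.reflections W → ℂ) (hc : RatCherednik.IsConjInvariant W c)
    (hfin : FiniteDimensional ℂ (RatCherednik.LTriv W α c)) :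
    -- `L(triv) = ℂ[𝔥]/I` as a graded algebra
    Function.Surjective (fun p : RatCherednik.PolyAlg V =>
        RatCherednik.polyHom W α c p • RatCherednik.lowestVector W α c) ∧
      RatCherednik.IsHomogeneousIdeal (RatCherednik.trivIdeal W α c) ∧
      RatCherednik.IsGorensteinRing
        (RatCherednik.PolyAlg V ⧸ RatCherednik.trivIdeal W α c) ∧
      RatCherednik.IsFrobeniusAlgebra ℂ
        (RatCherednik.PolyAlg V ⧸ RatCherednik.trivIdeal W α c) := by
  have hfinW : Finite W := hW.1
  -- Finiteness makes the `finsum` in the defining relation a genuine sum.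
  have : Fintype (RatCherednik.reflections W) := Fintype.ofFinite _
  obtain ⟨μ, hμ⟩ := RatCherednik.exists_mem_weightSpace W c (stdOrthonormalBasis ℝ V) hα
    (RatCherednik.w_smul_lowestVector W α c) (RatCherednik.y_smul_lowestVector W α c)
  have hfrob := RatCherednik.quotient_trivIdeal_isFrobeniusAlgebra W c hα
  exact ⟨RatCherednik.polyHom_smul_lowestVector_surjective W α c,
    RatCherednik.trivIdeal_isHomogeneous W c (stdOrthonormalBasis ℝ V) hα hμ,
    hfrob.isGorensteinRing, hfrob⟩
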